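/- Let $(X,Y)$ be a pair of real-valued random variables on a probability space $(\Omega,\mathcal{A},\mathbb{P})$ whose joint distribution is totally positive of order two (TP2), that is, \[ \mathbb{P}(X\in A_2,\,Y\in B_1)\,\mathbb{P}(X\in A_1,\,Y\in B_2)\ \le\ \mathbb{P}(X\in A_1,\,Y\in B_1)\,\mathbb{P}(X\in A_2,\,Y\in B_2) \] for all Borel sets $A_1<A_2$ and $B_1<B_2$ (element-wise). Let $Q$ be the distribution of $Y$, let \[ \mathcal{X}:=\{x\in\mathbb{R}:\ \mathbb{P}(X\le x)>0 \text{ and } \mathbb{P}(X\ge x)>0\} \] be the range of $X$, and for $x\in\mathbb{R}$ put \[ S_{\rm nw}(x):=\min\{y\in[-\infty,\infty]:\ \mathbb{P}(X\le x,\,Y>y)=0\},\qquad S_{\rm se}(x):=\max\{y\in[-\infty,\infty]:\ \mathbb{P}(X\ge x,\,Y<y)=0\}. \] Let $\mathcal{X}_o:=\{x\in\mathcal{X}:\ S_{\rm nw}(x)\le S_{\rm se}(x)\}$. For probability measures $\mu,\nu$ on $\mathbb{R}$ write $\mu\le_{\rm lr}\nu$ (likelihood ratio order) if $\mu(B)\,\nu(A)\le\mu(A)\,\nu(B)$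 for all Borel sets $A\le B$ (element-wise). Then there exist isotonic (i.e. non-decreasing) functions $S:\mathcal{X}_o\to\mathbb{R}$ with $S_{\rm nw}(x)\le S(x)\le S_{\rm se}(x)$ for all $x\in\mathcal{X}_o$; and for every such function $S$ there is a stochastic kernel $K$ from $\mathbb{R}$ to $\mathbb{R}$ which describes the conditional distribution of $Y$ given $X$, i.e. $\mathbb{P}(X\in A,\,Y\in B)=\mathbb{E}\bigl(1_A(X)\,K(X,B)\bigr)$ for all Borel sets $A,B$, such that $K(x_1,\cdot)\le_{\rm lr}K(x_2,\cdot)$ for all $x_1<x_2$ in $\mathcal{X}$, and such that the following hold. (a) If $x\in\mathcal{X}_o$, then $K(x,\cdot)=\delta_{S(x)}$. (b) There is a function $h$ such that for every $x\in\mathcal{X}\setminus\mathcal{X}_o$, $h(x,\cdot)$ is a bounded (measurable, non-negative) density of $K(x,\cdot)$ with respect to $Q$, and $h(x,y)=0$ whenever $y<S_{\rm se}(x)$ or $y>S_{\rm nw}(x)$. Moreover, $h$ is TP2 on $(\mathcal{X}\setminus\mathcal{X}_o)\times\mathbb{R}$, that is, \[ h(x_2,y_1)\,h(x_1,y_2)\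 \le\ h(x_1,y_1)\,h(x_2,y_2) \] for all $x_1<x_2$ in $\mathcal{X}\setminus\mathcal{X}_o$ and all real numbers $y_1<y_2$. -/

import Mathlib

open MeasureTheory ProbabilityTheory
open scoped ENNReal

namespace LikelihoodRatio

/-- Likelihood ratio order `μ ≤_lr ν`: `μ(B) ν(A) ≤ μ(A) ν(B)` for all Borel sets `A ≤ B`
(element-wise). -/
def LRLe (μ ν : Measure ℝ) : Prop :=
  ∀ A B : Set ℝ, MeasurableSet A → MeasurableSet B → (∀ a ∈ A, ∀ b ∈ B, a ≤ b) →
    μ B * ν A ≤ μ A * ν B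

/-- Total positivity of order two of a distribution on `ℝ × ℝ`. -/
def IsTP2Measure (R : Measure (ℝ × ℝ)) : Prop :=
  ∀ A₁ A₂ B₁ B₂ : Set ℝ, MeasurableSet A₁ → MeasurableSet A₂ →
    MeasurableSet B₁ → MeasurableSet B₂ →
    (∀ a₁ ∈ A₁, ∀ a₂ ∈ A₂, a₁ < a₂) → (∀ b₁ ∈ B₁, ∀ b₂ ∈ B₂, b₁ < b₂) →
    R (A₂ ×ˢ B₁) * R (A₁ ×ˢ B₂) ≤ R (A₁ ×ˢ B₁) * R (A₂ ×ˢ B₂)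

/-- Total positivity of order two of a function `h` on `D × ℝ`. -/
def IsTP2On (h : ℝ → ℝ → ℝ) (D : Set ℝ) : Prop :=
  ∀ x₁ ∈ D, ∀ x₂ ∈ D, x₁ < x₂ → ∀ y₁ y₂ : ℝ, y₁ < y₂ →
    h x₂ y₁ * h x₁ y₂ ≤ h x₁ y₁ * h x₂ y₂

section Pair

variable {Ω : Type*} [MeasurableSpace Ω]

/-- The range of `X`: the points `x` with `P(X ≤ x) > 0` and `P(X ≥ x) > 0`. -/
def range (P : Measure Ω) (X : Ω → ℝ) : Set ℝ :=
  {x | 0 < P {ω | X ω ≤ x} ∧ 0 < P {ω | x ≤ X ω}}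

/-- The northwest boundary, the least `y ∈ [-∞, ∞]` with `P(X ≤ x, Y > y) = 0`;
see `isLeast_Snw`. -/
noncomputable def Snw (P : Measure Ω) (X Y : Ω → ℝ) (x : ℝ) : EReal :=
  sInf {y : EReal | P {ω | X ω ≤ x ∧ y < (Y ω : EReal)} = 0}

/-- The southeast boundary, the greatest `y ∈ [-∞, ∞]` with `P(X ≥ x, Y < y) = 0`;
see `isGreatest_Sse`. -/
noncomputable def Sse (P : Measure Ω) (X Y : Ω → ℝ) (x : ℝ) : EReal :=
  sSup {y : EReal | P {ω | x ≤ X ω ∧ (Y ω : EReal) < y} = 0}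

/-- The infimum defining `Snw` is a minimum. -/
theorem isLeast_Snw (P : Measure Ω) (X Y : Ω → ℝ) (x : ℝ) :
    IsLeast {y : EReal | P {ω | X ω ≤ x ∧ y < (Y ω : EReal)} = 0} (Snw P X Y x) := by
  refine ⟨?_, fun y hy => sInf_le hy⟩
  obtain ⟨u, -, hu, huS⟩ := exists_seq_tendsto_sInf
    (S := {y : EReal | P {ω | X ω ≤ x ∧ y < (Y ω : EReal)} = 0})
    ⟨⊤, by simp⟩ (OrderBot.bddBelow _)
  refine measure_mono_null (t := ⋃ n, {ω | X ω ≤ x ∧ u n < (Y ω : EReal)}) ?_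
    (measure_iUnion_null huS)
  rintro ω ⟨h₁, h₂⟩
  obtain ⟨n, hn⟩ := (hu.eventually_lt_const h₂).exists
  exact Set.mem_iUnion.2 ⟨n, h₁, hn⟩

/-- The supremum defining `Sse` is a maximum. -/
theorem isGreatest_Sse (P : Measure Ω) (X Y : Ω → ℝ) (x : ℝ) :
    IsGreatest {y : EReal | P {ω | x ≤ X ω ∧ (Y ω : EReal) < y} = 0} (Sse P X Y x) := by
  refine ⟨?_, fun y hy => le_sSup hy⟩
  obtain ⟨u, -, hu, huS⟩ := exists_seq_tendsto_sSup
    (S := {y : EReal | P {ω | x ≤ X ω ∧ (Y ω : EReal) < y} = 0})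
    ⟨⊥, by simp⟩ (OrderTop.bddAbove _)
  refine measure_mono_null (t := ⋃ n, {ω | x ≤ X ω ∧ (Y ω : EReal) < u n}) ?_
    (measure_iUnion_null huS)
  rintro ω ⟨h₁, h₂⟩
  obtain ⟨n, hn⟩ := (hu.eventually_const_lt h₂).exists
  exact Set.mem_iUnion.2 ⟨n, h₁, hn⟩

/-- The part of the range of `X` on which `Snw ≤ Sse`. -/
def rangeO (P : Measure Ω) (X Y : Ω → ℝ) : Set ℝ :=
  {x ∈ range P X | Snw P X Y x ≤ Sse P X Y x}

/-- `S` restricts to an isotonic function on `rangeO` lying between the two boundaries; its values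
outside `rangeO` are irrelevant. -/
def IsIsotonicSelection (P : Measure Ω) (X Y : Ω → ℝ) (S : ℝ → ℝ) : Prop :=
  MonotoneOn S (rangeO P X Y) ∧
    ∀ x ∈ rangeO P X Y, Snw P X Y x ≤ (S x : EReal) ∧ (S x : EReal) ≤ Sse P X Y x

end Pair

/-- `g` is a bounded density of `ν` with respect to `Q`. -/
def IsBoundedDensity (g : ℝ → ℝ) (ν Q : Measure ℝ) : Prop :=
  Measurable g ∧ (∀ y, 0 ≤ g y) ∧ (∃ C : ℝ, ∀ y, g y ≤ C) ∧
    ν = Q.withDensity fun y => ENNReal.ofReal (g y)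

end LikelihoodRatio

/-! TP2 says exactly that slices `B ↦ R (A ×ˢ B)` of the joint law `R` over separated sets `A` are
ordered by likelihood ratio. The conditional law at every point `x` of the range of `X` is built so
as to fit between the slices over subsets of `Iic x` and those over subsets of `Ici x`; this
sandwich drives the whole proof.

On `rangeO` the mass left of `x` lies below `S x` and the mass right of `x` lies above it, so
`δ_{S(x)}` fits. Elsewhere some real `y` lies strictly between `Sse` and `Snw`, so there is positive
mass northwest and southeast of `(x, y)`. Comparison with these two masses bounds normalized slices
just right of `x` by a fixed multiple of the law `Q` of `Y`. The domination yields a setwise limit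
along an ultrafilter that is again a measure (`exists_tendsto_measure`, `exists_isRightLimit`).
Slices to the right may charge values above `Snw x`, so they are first cut off there; the order
survives because the cut is at a lower set that carries the slices to the left.

The sandwich has three consequences. The family is isotonic, hence a measurable kernel
(`measurable_of_strictLRLe`). It disintegrates `R`, by comparing `K x (Iic c)` with the
Radon-Nikodym derivative of the slice masses of `Iic c` (`compProd_eq_of_strictLRLe`). Finally, a
density defined at every point by ball quotients inherits the TP2 inequality everywhere, and it is
measurable because it is built from monotone functions (`measurable_ballDensity`). -/

open Set Filter Topology

namespace LikelihoodRatio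

/-! ### The likelihood ratio order tested on strictly separated sets -/

/-- The likelihood ratio order, tested only on strictly separated Borel sets. -/
def StrictLRLe (μ ν : Measure ℝ) : Prop :=
  ∀ B₁ B₂ : Set ℝ, MeasurableSet B₁ → MeasurableSet B₂ → (∀ b₁ ∈ B₁, ∀ b₂ ∈ B₂, b₁ < b₂) →
    μ B₂ * ν B₁ ≤ μ B₁ * ν B₂

namespace StrictLRLe

variable {μ μ₁ μ₂ ν ν₁ ν₂ : Measure ℝ}

theorem refl (μ : Measure ℝ) : StrictLRLe μ μ := fun _ _ _ _ _ => (mul_comm _ _).le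

theorem zero_left (ν : Measure ℝ) : StrictLRLe 0 ν := fun _ _ _ _ _ => by simp

theorem zero_right (μ : Measure ℝ) : StrictLRLe μ 0 := fun _ _ _ _ _ => by simp

theorem add_left (h₁ : StrictLRLe μ₁ ν) (h₂ : StrictLRLe μ₂ ν) : StrictLRLe (μ₁ + μ₂) ν := by
  intro B₁ B₂ m₁ m₂ h
  simp only [Measure.add_apply, add_mul]
  exact add_le_add (h₁ _ _ m₁ m₂ h) (h₂ _ _ m₁ m₂ h)

theorem add_right (h₁ : StrictLRLe μ ν₁) (h₂ : StrictLRLe μ ν₂) : StrictLRLe μ (ν₁ + ν₂) := by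
  intro B₁ B₂ m₁ m₂ h
  simp only [Measure.add_apply, mul_add]
  exact add_le_add (h₁ _ _ m₁ m₂ h) (h₂ _ _ m₁ m₂ h)

theorem smul_left (c : ℝ≥0∞) (h : StrictLRLe μ ν) : StrictLRLe (c • μ) ν := by
  intro B₁ B₂ m₁ m₂ hB
  simp only [Measure.smul_apply, smul_eq_mul, mul_assoc]
  exact mul_le_mul_right (h _ _ m₁ m₂ hB) c

theorem smul_right (c : ℝ≥0∞) (h : StrictLRLe μ ν) : StrictLRLe μ (c • ν) := by
  intro B₁ B₂ m₁ m₂ hB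
  simp only [Measure.smul_apply, smul_eq_mul, mul_left_comm _ c]
  exact mul_le_mul_right (h _ _ m₁ m₂ hB) c

/-- Restricting the smaller measure to a lower set keeps the order. -/
theorem restrict_left {L : Set ℝ} (hL : MeasurableSet L) (hL' : IsLowerSet L)
    (h : StrictLRLe μ ν) : StrictLRLe (μ.restrict L) ν := by
  intro B₁ B₂ m₁ m₂ hB
  rw [Measure.restrict_apply m₁, Measure.restrict_apply m₂]
  rcases (B₂ ∩ L).eq_empty_or_nonempty with he | ⟨b, hb, hbL⟩
  · simp [he]
  · have : B₁ ∩ L = B₁ := inter_eq_left.2 fun a ha => hL' (hB a ha b hb).le hbL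
    rw [this]
    refine (h B₁ (B₂ ∩ L) m₁ (m₂.inter hL) fun a ha b hb => hB a ha b hb.1).trans ?_
    gcongr
    exact inter_subset_left

/-- Restricting the larger measure to a set carrying the smaller one keeps the order. -/
theorem restrict_right {L : Set ℝ} (hL : MeasurableSet L) (hμ : μ Lᶜ = 0)
    (h : StrictLRLe μ ν) : StrictLRLe μ (ν.restrict L) := by
  intro B₁ B₂ m₁ m₂ hB
  rw [Measure.restrict_apply m₁, Measure.restrict_apply m₂]
  have : μ B₂ = μ (B₂ ∩ L) := (measure_inter_conull hμ).symm
  rw [this]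
  refine (h (B₁ ∩ L) (B₂ ∩ L) (m₁.inter hL) (m₂.inter hL)
    fun a ha b hb => hB a ha.1 b hb.1).trans ?_
  gcongr
  exact inter_subset_left

/-- Measures separated by a point are ordered. -/
theorem of_separated {s : ℝ} (hμ : μ (Ioi s) = 0) (hν : ν (Iio s) = 0) : StrictLRLe μ ν := by
  intro B₁ B₂ _ _ hB
  by_cases h₂ : B₂ ⊆ Ioi s
  · simp [measure_mono_null h₂ hμ]
  · obtain ⟨b, hb, hbs⟩ := not_subset.1 h₂
    have : B₁ ⊆ Iio s := fun a ha => (hB a ha b hb).trans_le (not_lt.1 hbs)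
    simp [measure_mono_null this hν]

/-- The order is preserved by setwise limits of finite measures. -/
theorem of_tendsto {ι : Type*} {l : Filter ι} [l.NeBot] {u v : ι → Measure ℝ}
    [IsFiniteMeasure μ] [IsFiniteMeasure ν]
    (hu : ∀ B, MeasurableSet B → Tendsto (fun i => u i B) l (𝓝 (μ B)))
    (hv : ∀ B, MeasurableSet B → Tendsto (fun i => v i B) l (𝓝 (ν B)))
    (h : ∀ᶠ i in l, StrictLRLe (u i) (v i)) : StrictLRLe μ ν := by
  intro B₁ B₂ m₁ m₂ hB
  refine le_of_tendsto_of_tendsto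
    (ENNReal.Tendsto.mul (hu _ m₂) (.inr (measure_ne_top _ _)) (hv _ m₁)
      (.inr (measure_ne_top _ _)))
    (ENNReal.Tendsto.mul (hu _ m₁) (.inr (measure_ne_top _ _)) (hv _ m₂)
      (.inr (measure_ne_top _ _))) ?_
  filter_upwards [h] with i hi using hi _ _ m₁ m₂ hB

/-- Weakly separated sets share at most one point, so testing strictly separated sets suffices. -/
theorem lrLe (h : StrictLRLe μ ν) : LRLe μ ν := by
  intro A B mA mB hAB
  rcases (A ∩ B).eq_empty_or_nonempty with he | ⟨c, hcA, hcB⟩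
  · refine h A B mA mB fun a ha b hb => (hAB a ha b hb).lt_of_ne ?_
    rintro rfl
    exact eq_empty_iff_forall_notMem.1 he a ⟨ha, hb⟩
  · have hA : A = (A \ {c}) ∪ {c} := by simp [hcA]
    have hB : B = (B \ {c}) ∪ {c} := by simp [hcB]
    have mc : MeasurableSet ({c} : Set ℝ) := measurableSet_singleton c
    have hA' : ∀ a ∈ A \ {c}, a < c := fun a ha => (hAB a ha.1 c hcB).lt_of_ne ha.2
    have hB' : ∀ b ∈ B \ {c}, c < b := fun b hb => (hAB c hcA b hb.1).lt_of_ne (Ne.symm hb.2)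
    have e : ∀ (ρ : Measure ℝ) (D : Set ℝ), ρ ((D \ {c}) ∪ {c}) = ρ (D \ {c}) + ρ {c} :=
      fun ρ D => measure_union disjoint_sdiff_left mc
    rw [hA, hB, e, e, e, e]
    have h₁ := h _ _ (mA.diff mc) (mB.diff mc) fun a ha b hb => (hA' a ha).trans (hB' b hb)
    have h₂ := h _ _ (mA.diff mc) mc fun a ha b hb => by
      rw [mem_singleton_iff.1 hb]; exact hA' a ha
    have h₃ := h _ _ mc (mB.diff mc) fun a ha b hb => by
      rw [mem_singleton_iff.1 ha]; exact hB' b hb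
    calc _ = μ (B \ {c}) * ν (A \ {c}) + μ {c} * ν (A \ {c}) + μ (B \ {c}) * ν {c}
            + μ {c} * ν {c} := by ring
      _ ≤ μ (A \ {c}) * ν (B \ {c}) + μ (A \ {c}) * ν {c} + μ {c} * ν (B \ {c})
            + μ {c} * ν {c} := by gcongr
      _ = _ := by ring

/-- The likelihood ratio order implies the usual stochastic order. -/
theorem measure_Iic_le (h : StrictLRLe μ ν) (c : ℝ) :
    ν (Iic c) * μ univ ≤ μ (Iic c) * ν univ := by
  have e : ∀ ρ : Measure ℝ, ρ univ = ρ (Iic c) + ρ (Ioi c) := fun ρ => by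
    rw [← measure_union (Iic_disjoint_Ioi le_rfl) measurableSet_Ioi, Iic_union_Ioi]
  have := h (Iic c) (Ioi c) measurableSet_Iic measurableSet_Ioi
    fun a ha b hb => lt_of_le_of_lt ha hb
  rw [e μ, e ν, mul_add, mul_add, mul_comm (ν (Iic c)) (μ (Iic c)), mul_comm (ν (Iic c))]
  gcongr

end StrictLRLe

/-! ### Slices of a measure on the plane -/

/-- The measure `B ↦ R (A ×ˢ B)`. -/
noncomputable def slice (R : Measure (ℝ × ℝ)) (A : Set ℝ) : Measure ℝ :=
  (R.restrict (A ×ˢ univ)).map Prod.snd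

section slice

variable {R : Measure (ℝ × ℝ)} {A A' B : Set ℝ}

theorem slice_apply (R : Measure (ℝ × ℝ)) (A : Set ℝ) (hB : MeasurableSet B) :
    slice R A B = R (A ×ˢ B) := by
  rw [slice, Measure.map_apply measurable_snd hB,
    Measure.restrict_apply (measurable_snd hB)]
  congr 1
  ext p
  simp [and_comm]

instance [IsFiniteMeasure R] : IsFiniteMeasure (slice R A) := by
  unfold slice; infer_instance

theorem slice_mono (h : A ⊆ A') : slice R A ≤ slice R A' :=
  Measure.map_mono (Measure.restrict_mono (prod_mono h subset_rfl) le_rfl) measurable_snd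

theorem slice_mono_apply (R : Measure (ℝ × ℝ)) (h : A ⊆ A') (B : Set ℝ) :
    slice R A B ≤ slice R A' B :=
  slice_mono h B

theorem slice_union (hA' : MeasurableSet A') (h : Disjoint A A') :
    slice R (A ∪ A') = slice R A + slice R A' := by
  rw [slice, union_prod, Measure.restrict_union (h.set_prod_left _ _) (hA'.prod .univ),
    Measure.map_add _ _ measurable_snd]
  rfl

theorem slice_eq_zero (h : slice R A univ = 0) (hA' : A' ⊆ A) : slice R A' = 0 :=
  Measure.measure_univ_eq_zero.1 (le_antisymm ((slice_mono_apply R hA' _).trans h.le) bot_le)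

theorem slice_apply_univ (R : Measure (ℝ × ℝ)) (hA : MeasurableSet A) :
    slice R A univ = R.fst A := by
  rw [slice_apply R A .univ, Measure.fst_apply hA]
  congr 1; ext; simp

theorem slice_univ (R : Measure (ℝ × ℝ)) : slice R univ = R.snd := by
  simp [slice, Measure.snd]

theorem tendsto_slice_iUnion {t : ℕ → Set ℝ} (ht : Monotone t)
    (hB : MeasurableSet B) :
    Tendsto (fun n => slice R (t n) B) atTop (𝓝 (slice R (⋃ n, t n) B)) := by
  simp only [slice_apply R _ hB, iUnion_prod_const]
  exact tendsto_measure_iUnion_atTop fun i j h => prod_mono (ht h) subset_rfl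

theorem IsTP2Measure.strictLRLe_slice (hR : IsTP2Measure R) (hA : MeasurableSet A)
    (hA' : MeasurableSet A') (h : ∀ a ∈ A, ∀ a' ∈ A', a < a') :
    StrictLRLe (slice R A) (slice R A') := by
  intro B₁ B₂ m₁ m₂ hB
  rw [slice_apply R A m₁, slice_apply R A m₂, slice_apply R A' m₁, slice_apply R A' m₂,
    mul_comm]
  exact hR A A' B₁ B₂ hA hA' m₁ m₂ h hB

end slice

/-! ### Limits along an ultrafilter -/

/-- The limit of a family of extended non-negative reals along an ultrafilter. -/
noncomputable def ulim (f : ℕ → ℝ≥0∞) : ℝ≥0∞ := ((hyperfilter ℕ).map f).lim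

theorem tendsto_ulim (f : ℕ → ℝ≥0∞) : Tendsto f (hyperfilter ℕ) (𝓝 (ulim f)) :=
  ((hyperfilter ℕ).map f).le_nhds_lim

theorem eventually_hyperfilter {p : ℕ → Prop} (h : ∀ᶠ n in atTop, p n) :
    ∀ᶠ n in (hyperfilter ℕ : Filter ℕ), p n :=
  h.filter_mono Nat.hyperfilter_le_atTop

/-- Uniformly dominated measures have a setwise limit along an ultrafilter. -/
theorem exists_tendsto_measure {α : Type*} [MeasurableSpace α] {μ : ℕ → Measure α}
    {Q : Measure α} [IsFiniteMeasure Q] {C : ℝ≥0∞}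
    (hC : C ≠ ∞) (h : ∀ᶠ n in atTop, ∀ B, MeasurableSet B → μ n B ≤ C * Q B) :
    ∃ κ : Measure α, ∀ B, MeasurableSet B →
      Tendsto (fun n => μ n B) (hyperfilter ℕ) (𝓝 (κ B)) := by
  set m : Set α → ℝ≥0∞ := fun B => ulim fun n => μ n B
  have ht : ∀ B, Tendsto (fun n => μ n B) (hyperfilter ℕ) (𝓝 (m B)) := fun B => tendsto_ulim _
  have hle : ∀ B, MeasurableSet B → m B ≤ C * Q B := fun B hB =>
    le_of_tendsto (ht B) ((eventually_hyperfilter h).mono fun n hn => hn B hB)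
  have h0 : m ∅ = 0 := by simpa using hle ∅ .empty
  have hadd : ∀ A B, MeasurableSet B → Disjoint A B → m (A ∪ B) = m A + m B := by
    intro A B hB hd
    refine tendsto_nhds_unique (ht _) ?_
    simp only [measure_union hd hB]
    exact (ht A).add (ht B)
  have hfin : ∀ f : ℕ → Set α, (∀ i, MeasurableSet (f i)) →
      Pairwise (Function.onFun Disjoint f) →
      ∀ N, m (⋃ i ∈ Finset.range N, f i) = ∑ i ∈ Finset.range N, m (f i) := by
    intro f mf hf N
    induction N with
    | zero => simp [h0]
    | succ N ih =>
      rw [Finset.sum_range_succ, ← ih, ← hadd _ _ (mf N)]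
      · congr 1
        rw [Finset.range_add_one, Finset.set_biUnion_insert, union_comm]
      · simp only [disjoint_iUnion_left, Finset.mem_range]
        exact fun i hi => hf hi.ne
  refine ⟨Measure.ofMeasurable (fun B _ => m B) h0 ?_, fun B hB => ?_⟩
  · intro f mf hf
    have h₁ : Tendsto (fun N => m (⋃ i ∈ Finset.range N, f i)) atTop (𝓝 (∑' i, m (f i))) := by
      simp only [hfin f mf hf]
      exact ENNReal.tendsto_nat_tsum _
    have mU : ∀ N, MeasurableSet (⋃ i ∈ Finset.range N, f i) := fun N =>
      Finset.measurableSet_biUnion _ fun i _ => mf i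
    have sU : ∀ N, (⋃ i ∈ Finset.range N, f i) ⊆ ⋃ i, f i := fun N =>
      iUnion₂_subset fun i _ => subset_iUnion f i
    -- Finite additivity passes to any limit. Countable additivity needs the domination: the mass of
    -- the tails is at most `C * Q` of sets decreasing to `∅`.
    have h₂ : Tendsto (fun N => C * Q ((⋃ i, f i) \ ⋃ i ∈ Finset.range N, f i)) atTop (𝓝 0) := by
      rw [← mul_zero C]
      refine ENNReal.Tendsto.const_mul ?_ (.inr hC)
      have := tendsto_measure_iInter_atTop (μ := Q)
        (s := fun N => (⋃ i, f i) \ ⋃ i ∈ Finset.range N, f i)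
        (fun N => ((MeasurableSet.iUnion mf).diff (mU N)).nullMeasurableSet)
        (fun N M hNM => sdiff_subset_sdiff_right <|
          biUnion_subset_biUnion_left fun i hi =>
            Finset.mem_range.2 ((Finset.mem_range.1 hi).trans_le hNM))
        ⟨0, measure_ne_top _ _⟩
      suffices he : ⋂ N, (⋃ i, f i) \ ⋃ i ∈ Finset.range N, f i = ∅ by
        rwa [he, measure_empty] at this
      rw [eq_empty_iff_forall_notMem]
      intro x hx
      simp only [mem_iInter, Set.mem_sdiff, mem_iUnion, Finset.mem_range] at hx
      obtain ⟨i, hi⟩ := (hx 0).1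
      exact (hx (i + 1)).2 ⟨i, Nat.lt_succ_self i, hi⟩
    have h₃ : ∀ N, m (⋃ i, f i) = m (⋃ i ∈ Finset.range N, f i)
        + m ((⋃ i, f i) \ ⋃ i ∈ Finset.range N, f i) := fun N => by
      rw [← hadd _ _ ((MeasurableSet.iUnion mf).diff (mU N)) disjoint_sdiff_right,
        union_sdiff_cancel (sU N)]
    have h₄ : Tendsto (fun N => m ((⋃ i, f i) \ ⋃ i ∈ Finset.range N, f i)) atTop (𝓝 0) :=
      tendsto_of_tendsto_of_tendsto_of_le_of_le tendsto_const_nhds h₂ (fun _ => bot_le)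
        fun N => hle _ ((MeasurableSet.iUnion mf).diff (mU N))
    have h₅ := h₁.add h₄
    simp only [← h₃, add_zero] at h₅
    exact tendsto_nhds_unique tendsto_const_nhds h₅
  · rw [Measure.ofMeasurable_apply B hB]
    exact ht B

/-! ### Conditional distributions as limits from the right -/

/-- Sets of positive measure shrinking, from the right, to the first point at or after `z` that is
charged by `μ`. -/
theorem exists_shrinking (μ : Measure ℝ) {z : ℝ} (h : μ (Ici z) ≠ 0) :
    ∃ r, z ≤ r ∧ μ (Ico z r) = 0 ∧ ∃ A : ℕ → Set ℝ, (∀ n, MeasurableSet (A n)) ∧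
      (∀ n, A n ⊆ Ico r (r + 1 / ((n : ℝ) + 1))) ∧ (∀ n, μ (A n) ≠ 0) ∧
      (μ {r} = 0 ∨ ∀ n, A n = {r}) := by
  set T : Set ℝ := {t | z ≤ t ∧ μ (Ico z t) = 0}
  have hzT : z ∈ T := ⟨le_rfl, by simp⟩
  have hbdd : BddAbove T := by
    by_contra hb
    refine h (measure_mono_null (t := ⋃ n : ℕ, Ico z n) ?_ (measure_iUnion_null fun n => ?_))
    · intro x hx
      obtain ⟨n, hn⟩ := exists_nat_gt x
      exact mem_iUnion.2 ⟨n, hx, hn⟩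
    · obtain ⟨t, ht, hnt⟩ := not_bddAbove_iff.1 hb n
      exact measure_mono_null (Ico_subset_Ico_right hnt.le) ht.2
  have hzr : z ≤ sSup T := le_csSup hbdd hzT
  have h0 : μ (Ico z (sSup T)) = 0 := by
    refine measure_null_of_locally_null _ fun x hx => ?_
    obtain ⟨t, ht, hxt⟩ := exists_lt_of_lt_csSup ⟨z, hzT⟩ hx.2
    refine ⟨Ico z t, ?_, ht.2⟩
    filter_upwards [self_mem_nhdsWithin, mem_nhdsWithin_of_mem_nhds (Iio_mem_nhds hxt)]
      with u hu hut using ⟨hu.1, hut⟩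
  have hpos : ∀ t, sSup T < t → μ (Ico (sSup T) t) ≠ 0 := by
    intro t ht h0'
    have : t ∈ T := ⟨hzr.trans ht.le, by
      rw [← Ico_union_Ico_eq_Ico hzr ht.le]; exact measure_union_null h0 h0'⟩
    exact ht.not_ge (le_csSup hbdd this)
  -- At an atom the sets must be the single point `r`: the limit has to be comparable in both
  -- directions with the slice over `{r}`.
  refine ⟨sSup T, hzr, h0, ?_⟩
  have hn : ∀ n : ℕ, sSup T < sSup T + 1 / ((n : ℝ) + 1) := fun n =>
    lt_add_of_pos_right _ Nat.one_div_pos_of_nat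
  by_cases ha : μ {sSup T} = 0
  · exact ⟨fun n => Ico (sSup T) (sSup T + 1 / ((n : ℝ) + 1)), fun n => measurableSet_Ico,
      fun n => subset_rfl, fun n => hpos _ (hn n), .inl ha⟩
  · exact ⟨fun _ => {sSup T}, fun _ => measurableSet_singleton _,
      fun n => by simpa using hn n, fun _ => ha, .inr fun _ => rfl⟩

/-- `κ` is a probability measure with bounded density with respect to the second marginal of `R`,
obtained as a limit of normalized slices of `R` to the right of `z`, cut off outside `L`, and
it fits between the slices on both sides of `z` in the likelihood ratio order. -/
structure IsRightLimit (R : Measure (ℝ × ℝ)) (z : ℝ) (L : Set ℝ) (κ : Measure ℝ) : Prop where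
  prob : IsProbabilityMeasure κ
  le_mul : ∃ C ≠ ∞, ∀ B, MeasurableSet B → κ B ≤ C * R.snd B
  compl_eq_zero : κ Lᶜ = 0
  eq_zero : ∀ B, MeasurableSet B → slice R (Ici z) B = 0 → κ B = 0
  le_slice : ∀ D, MeasurableSet D → D ⊆ Ici z → StrictLRLe κ (slice R D)
  slice_le : ∀ D, MeasurableSet D → D ⊆ Iic z → StrictLRLe (slice R D) κ
  approx : ∃ (A : ℕ → Set ℝ) (c : ℕ → ℝ≥0∞), (∀ n, MeasurableSet (A n)) ∧ (∀ n, A n ⊆ Ici z) ∧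
    ∀ B, MeasurableSet B →
      Tendsto (fun n => (c n • (slice R (A n)).restrict L) B) (hyperfilter ℕ) (𝓝 (κ B))

/-- `κ₂` is a limit of cut-off slices over subsets of `Ici z₂`, which lie in `Ici z₁`, and `κ₁` lies
below each of those. The cut to `L₂` is harmless since `κ₁` lives on `L₁ ⊆ L₂`. -/
theorem IsRightLimit.strictLRLe {R : Measure (ℝ × ℝ)} {z₁ z₂ : ℝ} {L₁ L₂ : Set ℝ}
    {κ₁ κ₂ : Measure ℝ} (h₁ : IsRightLimit R z₁ L₁ κ₁) (h₂ : IsRightLimit R z₂ L₂ κ₂)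
    (hz : z₁ ≤ z₂) (hL : L₁ ⊆ L₂) (mL : MeasurableSet L₂) : StrictLRLe κ₁ κ₂ := by
  have := h₁.prob
  have := h₂.prob
  obtain ⟨A, c, mA, hA, ht⟩ := h₂.approx
  refine StrictLRLe.of_tendsto (l := (hyperfilter ℕ : Filter ℕ)) (u := fun _ => κ₁)
    (fun B _ => tendsto_const_nhds) ht (.of_forall fun n => ?_)
  exact ((h₁.le_slice _ (mA n) ((hA n).trans (Ici_subset_Ici.2 hz))).restrict_right mL
    (measure_mono_null (compl_subset_compl.2 hL) h₁.compl_eq_zero)).smul_right _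

theorem measure_eq_add_of_lt (μ : Measure ℝ) (y : ℝ) {B : Set ℝ} :
    μ B = μ (B ∩ Iio y) + μ (B ∩ Ici y) := by
  rw [← measure_inter_add_sdiff B measurableSet_Iio (t := Iio y), sdiff_eq, compl_Iio]

/-- The level `y` only serves to bound the density: mass left of `z` above `y` controls the slices
below `y`, and mass right of `z` below `y` controls them above `y`. -/
theorem exists_isRightLimit {R : Measure (ℝ × ℝ)} [IsFiniteMeasure R] (hR : IsTP2Measure R)
    {z y : ℝ} {L : Set ℝ} (mL : MeasurableSet L) (hL : IsLowerSet L) (hyL : Iio y ⊆ L)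
    (hLz : slice R (Iic z) Lᶜ = 0) (hα : slice R (Iic z) (Ici y) ≠ 0)
    (hβ : slice R (Ici z) (Iio y) ≠ 0) : ∃ κ, IsRightLimit R z L κ := by
  have hz : R.fst (Ici z) ≠ 0 := by
    rw [← slice_apply_univ R measurableSet_Ici]
    exact fun h => hβ (measure_mono_null (subset_univ _) h)
  obtain ⟨r, hzr, hr0, A, mA, hAr, hA0, hatom⟩ := exists_shrinking R.fst hz
  have hAz : ∀ n, A n ⊆ Ici z := fun n x hx => hzr.trans (hAr n hx).1
  have hgap : ∀ D ⊆ Ico z r, slice R D = 0 := fun D hD =>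
    slice_eq_zero (A := Ico z r) (by rw [slice_apply_univ R measurableSet_Ico, hr0]) hD
  have hA0' : ∀ n, slice R (A n) univ ≠ 0 := fun n => by
    rw [slice_apply_univ R (mA n)]; exact hA0 n
  have hpoint : ∀ n, ∀ D ⊆ {r}, slice R D = 0 ∨ D = A n := by
    intro n D hD
    rcases hatom with h | h
    · exact .inl (slice_eq_zero (A := {r})
        (by rw [slice_apply_univ R (measurableSet_singleton r), h]) hD)
    · rcases subset_singleton_iff_eq.1 hD with rfl | rfl
      · exact .inl (by simp [slice])
      · exact .inr (h n).symm
  have hlower : ∀ n D, MeasurableSet D → D ⊆ Iic z → StrictLRLe (slice R D) (slice R (A n)) := by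
    intro n D mD hD
    rw [← inter_union_sdiff D (Iio z), slice_union (mD.diff measurableSet_Iio)
      (disjoint_sdiff_right.mono_left inter_subset_right)]
    refine .add_left (hR.strictLRLe_slice (mD.inter measurableSet_Iio) (mA n)
      fun a ha b hb => lt_of_lt_of_le ha.2 (hAz n hb)) ?_
    -- The point `z` itself is not strictly left of `A n` when `z = r`; then its slice vanishes or
    -- coincides with that over `A n`.
    have hDz : D \ Iio z ⊆ {z} := fun x hx => le_antisymm (hD hx.1) (not_lt.1 hx.2)
    rcases hzr.eq_or_lt with rfl | hlt
    · rcases hpoint n _ hDz with h | h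
      · rw [h]; exact .zero_left _
      · rw [h]; exact .refl _
    · rw [hgap _ (hDz.trans (by simpa using hlt))]; exact .zero_left _
  have hupper : ∀ m n : ℕ, m ≤ n → ∀ D, MeasurableSet D → D ⊆ Ici (r + 1 / ((m : ℝ) + 1)) →
      StrictLRLe (slice R (A n)) (slice R D) := fun m n hmn D mD hD =>
    hR.strictLRLe_slice (mA n) mD fun a ha b hb => (hAr n ha).2.trans_le
      ((add_le_add_right (Nat.one_div_le_one_div hmn) r).trans (hD hb))
  have hright : ∀ D : Set ℝ,
      ⋃ m : ℕ, D ∩ Ici (r + 1 / ((m : ℝ) + 1)) = D ∩ Ioi r := by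
    intro D
    rw [← inter_iUnion]
    congr 1
    ext x
    simp only [mem_iUnion, mem_Ici, mem_Ioi]
    constructor
    · rintro ⟨m, hm⟩
      exact (lt_add_of_pos_right r Nat.one_div_pos_of_nat).trans_le hm
    · intro hx
      obtain ⟨m, hm⟩ := exists_nat_one_div_lt (sub_pos.2 hx)
      exact ⟨m, by linarith⟩
  have hmono : ∀ D : Set ℝ, Monotone fun m : ℕ => D ∩ Ici (r + 1 / ((m : ℝ) + 1)) :=
    fun D m n hmn => inter_subset_inter_right D <| Ici_subset_Ici.2 <|
      add_le_add_right (Nat.one_div_le_one_div hmn) r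
  have hβ' : slice R {r} (Iio y) ≠ 0 ∨ slice R (Ioi r) (Iio y) ≠ 0 := by
    by_contra! hcon
    refine hβ ?_
    rw [← Ico_union_Ici_eq_Ici hzr, slice_union measurableSet_Ici
      (disjoint_left.2 fun x hx hx' => hx.2.not_ge hx'),
      hgap _ subset_rfl, ← Ioi_insert, ← singleton_union,
      slice_union measurableSet_Ioi (by simp)]
    simp [hcon]
  have hQ : ∀ D B, slice R D B ≤ R.snd B := fun D B => by
    rw [← slice_univ]; exact slice_mono_apply R (subset_univ D) B
  -- the cut-off slices have positive mass and satisfy a uniform density bound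
  obtain ⟨C, hC, hbound⟩ : ∃ C ≠ ∞, ∀ᶠ n in atTop, slice R (A n) L ≠ 0 ∧
      ∀ B, MeasurableSet B → slice R (A n) (B ∩ L) ≤ slice R (A n) L * (C * R.snd B) := by
    rcases hatom with ha | ha
    · have ha' : slice R {r} = 0 := slice_eq_zero (A := {r})
        (by rw [slice_apply_univ R (measurableSet_singleton r), ha]) subset_rfl
      obtain ⟨m, hm⟩ : ∃ m : ℕ, slice R (Ici (r + 1 / ((m : ℝ) + 1))) (Iio y) ≠ 0 := by
        have h1 : slice R (Ioi r) (Iio y) ≠ 0 := hβ'.resolve_left (by simp [ha'])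
        have h2 := tendsto_slice_iUnion (R := R) (hmono univ)
          (measurableSet_Iio (a := y))
        rw [hright] at h2
        simp only [univ_inter] at h2
        exact ((h2.eventually_ne h1).exists)
      -- `C = α⁻¹ + β⁻¹`, with `α⁻¹` paying for the part of `B` below `y` and `β⁻¹` for the part
      -- above. For `n ≥ m`, the set `A n` lies left of the set defining `β`.
      refine ⟨(slice R (Iic z) (Ici y))⁻¹ + (slice R (Ici (r + 1 / ((m : ℝ) + 1))) (Iio y))⁻¹,
        ENNReal.add_ne_top.2 ⟨ENNReal.inv_ne_top.2 hα, ENNReal.inv_ne_top.2 hm⟩, ?_⟩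
      filter_upwards [eventually_ge_atTop m] with n hn
      set α := slice R (Iic z) (Ici y)
      set β := slice R (Ici (r + 1 / ((m : ℝ) + 1))) (Iio y)
      have hup := hupper m n hn _ measurableSet_Ici subset_rfl
      have hlo := hlower n _ measurableSet_Iic subset_rfl
      have hsep : ∀ a ∈ Iio y, ∀ b ∈ Ici y, a < b := fun a ha b hb => lt_of_lt_of_le ha hb
      constructor
      -- No mass on `L` means none below `y`; comparison with `β ≠ 0` then leaves none above `y`
      -- either, although `A n` is charged.
      · intro h0
        have h1 : slice R (A n) (Iio y) = 0 := measure_mono_null hyL h0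
        have h2 := hup _ _ measurableSet_Iio measurableSet_Ici hsep
        rw [h1, zero_mul, nonpos_iff_eq_zero, mul_eq_zero, or_iff_left hm] at h2
        refine hA0' n ?_
        rw [← Iio_union_Ici (a := y)]
        exact measure_union_null h1 h2
      · intro B mB
        have h1 := (hlo.restrict_right mL hLz) (B ∩ Iio y) (Ici y) (mB.inter measurableSet_Iio)
          measurableSet_Ici fun a ha b hb => hsep a ha.2 b hb
        have h2 := (hup.restrict_left mL hL) (Iio y) (B ∩ Ici y) measurableSet_Iio
          (mB.inter measurableSet_Ici) fun a ha b hb => hsep a ha b hb.2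
        rw [Measure.restrict_apply (mB.inter measurableSet_Iio),
          Measure.restrict_apply measurableSet_Ici] at h1
        rw [Measure.restrict_apply (mB.inter measurableSet_Ici),
          Measure.restrict_apply measurableSet_Iio] at h2
        have h3 : slice R (A n) (B ∩ Iio y ∩ L) ≤ α⁻¹ * (R.snd B * slice R (A n) L) := by
          rw [← ENNReal.div_eq_inv_mul,
            ENNReal.le_div_iff_mul_le (.inl hα) (.inl (measure_ne_top _ _)), mul_comm _ α]
          exact h1.trans (mul_le_mul' ((measure_mono inter_subset_left).trans (hQ _ B))
            (measure_mono inter_subset_right))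
        have h4 : slice R (A n) (B ∩ Ici y ∩ L) ≤ β⁻¹ * (R.snd B * slice R (A n) L) := by
          rw [← ENNReal.div_eq_inv_mul,
            ENNReal.le_div_iff_mul_le (.inl hm) (.inl (measure_ne_top _ _)), mul_comm (R.snd B)]
          exact h2.trans (mul_le_mul' (measure_mono inter_subset_right)
            ((measure_mono inter_subset_left).trans (hQ _ B)))
        rw [measure_eq_add_of_lt _ y, inter_right_comm, inter_right_comm B L (Ici y)]
        refine (add_le_add h3 h4).trans_eq ?_
        ring
    · have hγ : slice R {r} L ≠ 0 := by
        intro h0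
        have h1 : slice R {r} (Iio y) = 0 := measure_mono_null hyL h0
        have h2 := hR.strictLRLe_slice (measurableSet_singleton r) measurableSet_Ioi
          (fun a ha b hb => by rw [mem_singleton_iff.1 ha]; exact hb) (Iio y) (Ici y)
          measurableSet_Iio measurableSet_Ici fun a ha b hb => lt_of_lt_of_le ha hb
        rw [h1, zero_mul, nonpos_iff_eq_zero, mul_eq_zero,
          or_iff_left (hβ'.resolve_left (not_not.2 h1))] at h2
        refine hA0' 0 ?_
        rw [ha 0, ← Iio_union_Ici (a := y)]
        exact measure_union_null h1 h2
      refine ⟨(slice R {r} L)⁻¹, ENNReal.inv_ne_top.2 hγ, .of_forall fun n => ?_⟩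
      rw [ha n]
      refine ⟨hγ, fun B _ => ?_⟩
      rw [← mul_assoc, ENNReal.mul_inv_cancel hγ (measure_ne_top _ _), one_mul]
      exact (measure_mono inter_subset_left).trans (hQ _ B)
  set c : ℕ → ℝ≥0∞ := fun n => (slice R (A n) L)⁻¹
  have happ : ∀ n B, MeasurableSet B →
      (c n • (slice R (A n)).restrict L) B = (slice R (A n) L)⁻¹ * slice R (A n) (B ∩ L) :=
    fun n B mB => by rw [Measure.smul_apply, Measure.restrict_apply mB, smul_eq_mul]
  have hdom : ∀ᶠ n in atTop, ∀ B, MeasurableSet B →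
      (c n • (slice R (A n)).restrict L) B ≤ C * R.snd B := by
    filter_upwards [hbound] with n hn B mB
    rw [happ n B mB, ← ENNReal.div_eq_inv_mul]
    exact ENNReal.div_le_of_le_mul' (hn.2 B mB)
  obtain ⟨κ, hκ⟩ := exists_tendsto_measure hC hdom
  have hprob : IsProbabilityMeasure κ := by
    constructor
    refine tendsto_nhds_unique (hκ univ .univ) (tendsto_const_nhds.congr' ?_)
    refine eventually_hyperfilter ?_
    filter_upwards [hbound] with n hn
    rw [happ n _ .univ, univ_inter, ENNReal.inv_mul_cancel hn.1 (measure_ne_top _ _)]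
  have hzero : ∀ B, MeasurableSet B → (∀ n, slice R (A n) (B ∩ L) = 0) → κ B = 0 := by
    intro B mB h
    refine tendsto_nhds_unique (hκ B mB) (tendsto_const_nhds.congr fun n => ?_)
    rw [happ n B mB, h n, mul_zero]
  refine ⟨κ, hprob, ⟨C, hC, fun B mB => ?_⟩, hzero _ mL.compl (by simp), fun B mB hB => ?_, ?_, ?_,
    A, c, mA, hAz, hκ⟩
  · exact le_of_tendsto (hκ B mB) (eventually_hyperfilter (hdom.mono fun n hn => hn B mB))
  · exact hzero B mB fun n => measure_mono_null inter_subset_left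
      (le_antisymm ((slice_mono_apply R (hAz n) B).trans hB.le) bot_le)
  · intro D mD hD
    -- `D` splits into a null part before `r`, the point `r`, and `D ∩ Ioi r`. The last is exhausted
    -- by sets at positive distance from `r`, which the `A n` eventually precede.
    have hstep : ∀ m : ℕ, StrictLRLe κ (slice R (D ∩ Ici (r + 1 / ((m : ℝ) + 1)))) := fun m =>
      .of_tendsto (l := (hyperfilter ℕ : Filter ℕ)) hκ (fun B _ => tendsto_const_nhds) <|
        eventually_hyperfilter <| (eventually_ge_atTop m).mono fun n hn =>
          ((hupper m n hn _ (mD.inter measurableSet_Ici) inter_subset_right).restrict_left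
            mL hL).smul_left _
    have hIoi : StrictLRLe κ (slice R (D ∩ Ioi r)) := by
      refine .of_tendsto (l := atTop) (u := fun _ : ℕ => κ) (fun B _ => tendsto_const_nhds)
        (fun B mB => ?_) (.of_forall hstep)
      rw [← hright D]
      exact tendsto_slice_iUnion (hmono D) mB
    have hsingle : StrictLRLe κ (slice R (D ∩ {r})) :=
      .of_tendsto (l := (hyperfilter ℕ : Filter ℕ)) hκ (fun B _ => tendsto_const_nhds) <|
        .of_forall fun n => by
          rcases hpoint n (D ∩ {r}) inter_subset_right with h | h
          · rw [h]; exact .zero_right _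
          · rw [h]; exact ((StrictLRLe.refl _).restrict_left mL hL).smul_left _
    have hDeq : D = D ∩ Ico z r ∪ (D ∩ {r} ∪ D ∩ Ioi r) := by
      rw [← inter_union_distrib_left, ← inter_union_distrib_left, singleton_union, Ioi_insert,
        Ico_union_Ici_eq_Ici hzr, inter_eq_left.2 hD]
    rw [hDeq, slice_union, slice_union, hgap _ inter_subset_right]
    · exact (StrictLRLe.zero_right κ).add_right (hsingle.add_right hIoi)
    · exact mD.inter measurableSet_Ioi
    · exact (disjoint_singleton_left.2 self_notMem_Ioi).mono inter_subset_right inter_subset_right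
    · exact (mD.inter (measurableSet_singleton r)).union (mD.inter measurableSet_Ioi)
    · rw [← inter_union_distrib_left, singleton_union, Ioi_insert]
      exact (disjoint_left.2 fun x hx hx' => hx.2.not_ge hx').mono inter_subset_right
        inter_subset_right
  · intro D mD hD
    refine .of_tendsto (l := (hyperfilter ℕ : Filter ℕ)) (fun B _ => tendsto_const_nhds) hκ
      (.of_forall fun n => ?_)
    exact ((hlower n D mD hD).restrict_right mL
      (le_antisymm ((slice_mono_apply R hD _).trans hLz.le) bot_le)).smul_right _

/-! ### A pointwise defined density -/

/-- The density of `κ` with respect to `Q`, defined at every point as the limit along an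
ultrafilter of the quotients of the measures of shrinking balls. -/
noncomputable def ballDensity (κ Q : Measure ℝ) (y : ℝ) : ℝ≥0∞ :=
  ulim fun n => κ (Metric.closedBall y (1 / ((n : ℝ) + 1))) /
    Q (Metric.closedBall y (1 / ((n : ℝ) + 1)))

theorem eventually_closedBall_subset {y : ℝ} {U : Set ℝ} (hU : U ∈ 𝓝 y) :
    ∀ᶠ n : ℕ in atTop, Metric.closedBall y (1 / ((n : ℝ) + 1)) ⊆ U := by
  obtain ⟨ε, hε, hεU⟩ := Metric.nhds_basis_closedBall.mem_iff.1 hU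
  filter_upwards [tendsto_one_div_add_atTop_nhds_zero_nat.eventually (ge_mem_nhds hε)] with n hn
  exact (Metric.closedBall_subset_closedBall hn).trans hεU

theorem eventually_closedBall_lt {y₁ y₂ : ℝ} (h : y₁ < y₂) :
    ∀ᶠ n : ℕ in atTop, ∀ a ∈ Metric.closedBall y₁ (1 / ((n : ℝ) + 1)),
      ∀ b ∈ Metric.closedBall y₂ (1 / ((n : ℝ) + 1)), a < b := by
  filter_upwards [eventually_closedBall_subset (Iio_mem_nhds (left_lt_add_div_two.2 h)),
    eventually_closedBall_subset (Ioi_mem_nhds (add_div_two_lt_right.2 h))] with n h₁ h₂ a ha b hb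
  exact (h₁ ha).trans (h₂ hb)

section

variable {κ κ₁ κ₂ Q Q₁ Q₂ : Measure ℝ} {C : ℝ≥0∞}

theorem tendsto_ballDensity (κ Q : Measure ℝ) (y : ℝ) :
    Tendsto (fun n : ℕ => κ (Metric.closedBall y (1 / ((n : ℝ) + 1))) /
      Q (Metric.closedBall y (1 / ((n : ℝ) + 1)))) (hyperfilter ℕ) (𝓝 (ballDensity κ Q y)) :=
  tendsto_ulim _

theorem ballDensity_le (h : ∀ B, MeasurableSet B → κ B ≤ C * Q B) (y : ℝ) :
    ballDensity κ Q y ≤ C :=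
  le_of_tendsto (tendsto_ballDensity κ Q y) <| .of_forall fun _ =>
    ENNReal.div_le_of_le_mul (h _ measurableSet_closedBall)

theorem ballDensity_eq_zero {y : ℝ} {U : Set ℝ} (hU : U ∈ 𝓝 y) (h : κ U = 0) :
    ballDensity κ Q y = 0 := by
  refine tendsto_nhds_unique (tendsto_ballDensity κ Q y) (tendsto_const_nhds.congr' ?_)
  filter_upwards [eventually_hyperfilter (eventually_closedBall_subset hU)] with n hn
  rw [measure_mono_null hn h, ENNReal.zero_div]

theorem ballDensity_ae_eq [IsFiniteMeasure κ] [IsFiniteMeasure Q] :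
    ballDensity κ Q =ᵐ[Q] κ.rnDeriv Q := by
  filter_upwards [Besicovitch.ae_tendsto_rnDeriv κ Q] with y hy
  refine tendsto_nhds_unique (tendsto_ballDensity κ Q y) ?_
  have : Tendsto (fun n : ℕ => 1 / ((n : ℝ) + 1)) atTop (𝓝[>] 0) :=
    tendsto_nhdsWithin_iff.2 ⟨tendsto_one_div_add_atTop_nhds_zero_nat,
      .of_forall fun _ => mem_Ioi.2 Nat.one_div_pos_of_nat⟩
  exact (hy.comp this).mono_left Nat.hyperfilter_le_atTop

/-- Small balls around `y₁ < y₂` are separated, so the measure inequality holds for them and passes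
to the limit. Using one ultrafilter throughout gives the result at every pair of points, not just
almost everywhere. -/
theorem StrictLRLe.ballDensity_mul_le (h : StrictLRLe κ₁ κ₂)
    (h₁ : ∀ y, ballDensity κ₁ Q y ≠ ∞) (h₂ : ∀ y, ballDensity κ₂ Q y ≠ ∞) {y₁ y₂ : ℝ}
    (hy : y₁ < y₂) :
    ballDensity κ₂ Q y₁ * ballDensity κ₁ Q y₂ ≤ ballDensity κ₁ Q y₁ * ballDensity κ₂ Q y₂ := by
  have t := tendsto_ballDensity
  refine le_of_tendsto_of_tendsto
    (ENNReal.Tendsto.mul (t κ₂ Q y₁) (.inr (h₁ _)) (t κ₁ Q y₂) (.inr (h₂ _)))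
    (ENNReal.Tendsto.mul (t κ₁ Q y₁) (.inr (h₂ _)) (t κ₂ Q y₂) (.inr (h₁ _))) ?_
  filter_upwards [eventually_hyperfilter (eventually_closedBall_lt hy)] with n hn
  have := h _ _ measurableSet_closedBall measurableSet_closedBall hn
  rw [mul_comm (κ₁ _)] at this
  rw [ENNReal.div_eq_inv_mul, ENNReal.div_eq_inv_mul, ENNReal.div_eq_inv_mul,
    ENNReal.div_eq_inv_mul, mul_mul_mul_comm, mul_mul_mul_comm (_⁻¹) (κ₁ _)]
  exact mul_le_mul_right this _

theorem measure_closedBall_ne_zero {y : ℝ} (hy : y ∈ κ.support) (n : ℕ) :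
    κ (Metric.closedBall y (1 / ((n : ℝ) + 1))) ≠ 0 :=
  ((Measure.mem_support_iff_forall y).1 hy _
    (Metric.closedBall_mem_nhds y Nat.one_div_pos_of_nat)).ne'

/-- On the support of the larger measure, `ballDensity` of the smaller one is antitone. -/
theorem StrictLRLe.antitoneOn_ballDensity [IsFiniteMeasure κ] (h : StrictLRLe Q κ) :
    AntitoneOn (ballDensity Q κ) κ.support := by
  intro y₁ h₁ y₂ h₂ hy
  rcases hy.eq_or_lt with rfl | hy
  · exact le_rfl
  refine le_of_tendsto_of_tendsto (tendsto_ballDensity _ _ _) (tendsto_ballDensity _ _ _) ?_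
  filter_upwards [eventually_hyperfilter (eventually_closedBall_lt hy)] with n hn
  have := h _ _ measurableSet_closedBall measurableSet_closedBall hn
  rw [ENNReal.div_le_iff (measure_closedBall_ne_zero h₂ n) (measure_ne_top _ _),
    ← ENNReal.mul_div_right_comm,
    ENNReal.le_div_iff_mul_le (.inl (measure_closedBall_ne_zero h₁ n)) (.inl (measure_ne_top _ _))]
  exact this

/-- On the support of the smaller measure, `ballDensity` of the larger one is isotonic. -/
theorem StrictLRLe.monotoneOn_ballDensity [IsFiniteMeasure κ] (h : StrictLRLe κ Q) :
    MonotoneOn (ballDensity Q κ) κ.support := by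
  intro y₁ h₁ y₂ h₂ hy
  rcases hy.eq_or_lt with rfl | hy
  · exact le_rfl
  refine le_of_tendsto_of_tendsto (tendsto_ballDensity _ _ _) (tendsto_ballDensity _ _ _) ?_
  filter_upwards [eventually_hyperfilter (eventually_closedBall_lt hy)] with n hn
  have := h _ _ measurableSet_closedBall measurableSet_closedBall hn
  rw [ENNReal.div_le_iff (measure_closedBall_ne_zero h₁ n) (measure_ne_top _ _),
    ← ENNReal.mul_div_right_comm,
    ENNReal.le_div_iff_mul_le (.inl (measure_closedBall_ne_zero h₂ n)) (.inl (measure_ne_top _ _)),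
    mul_comm, mul_comm (Q _)]
  exact this

/-- Ultrafilter limits of measurable functions need not be measurable. Here, on the support of `κ`,
the density is the inverse of the sum of the densities of `Q₁` and `Q₂` with respect to `κ`, one
antitone and the other isotonic; off the support it vanishes. -/
theorem measurable_ballDensity [IsFiniteMeasure κ] (h₁ : StrictLRLe Q₁ κ)
    (h₂ : StrictLRLe κ Q₂) : Measurable (ballDensity κ (Q₁ + Q₂)) := by
  obtain ⟨g₁, hg₁, e₁⟩ := h₁.antitoneOn_ballDensity.exists_antitone_extension
    (OrderBot.bddBelow _) (OrderTop.bddAbove _)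
  obtain ⟨g₂, hg₂, e₂⟩ := h₂.monotoneOn_ballDensity.exists_monotone_extension
    (OrderBot.bddBelow _) (OrderTop.bddAbove _)
  have : ballDensity κ (Q₁ + Q₂) = κ.support.indicator fun y => (g₁ y + g₂ y)⁻¹ := by
    ext y
    by_cases hy : y ∈ κ.support
    · rw [indicator_of_mem hy, ← e₁ hy, ← e₂ hy]
      refine tendsto_nhds_unique (tendsto_ballDensity _ _ _) ?_
      refine ((tendsto_ballDensity Q₁ κ y).add (tendsto_ballDensity Q₂ κ y)).inv.congr fun n => ?_
      rw [← ENNReal.add_div, ENNReal.inv_div (.inl (measure_ne_top _ _)), Measure.add_apply]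
      exact .inl (measure_closedBall_ne_zero hy n)
    · rw [indicator_of_notMem hy]
      obtain ⟨U, hU, h0⟩ := Measure.notMem_support_iff_exists.1 hy
      exact ballDensity_eq_zero hU h0
  rw [this]
  exact (hg₁.measurable.add hg₂.measurable).inv.indicator
    Measure.isClosed_support.measurableSet

theorem isBoundedDensity_ballDensity [IsFiniteMeasure κ] [IsFiniteMeasure Q] (hC : C ≠ ∞)
    (h : ∀ B, MeasurableSet B → κ B ≤ C * Q B) (hm : Measurable (ballDensity κ Q)) :
    IsBoundedDensity (fun y => (ballDensity κ Q y).toReal) κ Q := by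
  refine ⟨hm.ennreal_toReal, fun _ => ENNReal.toReal_nonneg,
    ⟨C.toReal, fun y => ENNReal.toReal_mono hC (ballDensity_le h y)⟩, ?_⟩
  have hac : κ ≪ Q := Measure.AbsolutelyContinuous.mk fun B hB h0 => by
    simpa [h0] using h B hB
  have e : (fun y => ENNReal.ofReal (ballDensity κ Q y).toReal) = ballDensity κ Q :=
    funext fun y => ENNReal.ofReal_toReal ((ballDensity_le h y).trans_lt hC.lt_top).ne
  rw [e, withDensity_congr_ae ballDensity_ae_eq, Measure.withDensity_rnDeriv_eq _ _ hac]

end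

/-! ### Ordered families of measures as conditional distributions -/

/-- `F` is locally null: a point that is not the minimum of `F` has a neighbourhood `Ici a` with `a
∈ F`, and if `x` is the minimum then `F ⊆ Ici x`. -/
theorem measure_eq_zero_of_inter_Ici {μ : Measure ℝ} {F : Set ℝ}
    (h : ∀ x ∈ F, μ (F ∩ Ici x) = 0) : μ F = 0 := by
  refine measure_null_of_locally_null _ fun x hx => ?_
  by_cases hx' : ∃ a ∈ F, a < x
  · obtain ⟨a, ha, hax⟩ := hx'
    exact ⟨_, inter_mem self_mem_nhdsWithin (mem_nhdsWithin_of_mem_nhds (Ici_mem_nhds hax)),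
      h a ha⟩
  · push Not at hx'
    exact ⟨_, inter_mem self_mem_nhdsWithin (mem_of_superset self_mem_nhdsWithin hx'), h x hx⟩

theorem measure_eq_zero_of_inter_Iic {μ : Measure ℝ} {F : Set ℝ}
    (h : ∀ x ∈ F, μ (F ∩ Iic x) = 0) : μ F = 0 := by
  refine measure_null_of_locally_null _ fun x hx => ?_
  by_cases hx' : ∃ a ∈ F, x < a
  · obtain ⟨a, ha, hax⟩ := hx'
    exact ⟨_, inter_mem self_mem_nhdsWithin (mem_nhdsWithin_of_mem_nhds (Iic_mem_nhds hax)),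
      h a ha⟩
  · push Not at hx'
    exact ⟨_, inter_mem self_mem_nhdsWithin (mem_of_superset self_mem_nhdsWithin hx'), h x hx⟩

/-- A family of probability measures which is isotonic for the likelihood ratio order on an
interval, and constant outside, is measurable. -/
theorem measurable_of_strictLRLe {K : ℝ → Measure ℝ} [∀ x, IsProbabilityMeasure (K x)]
    {I : Set ℝ} (hI : I.OrdConnected) {ρ : Measure ℝ} (hρ : ∀ x ∉ I, K x = ρ)
    (hK : ∀ x₁ ∈ I, ∀ x₂ ∈ I, x₁ < x₂ → StrictLRLe (K x₁) (K x₂)) : Measurable K := by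
  refine Measurable.measure_of_isPiSystem_of_isProbabilityMeasure
    (borel_eq_generateFrom_Iic ℝ ▸ BorelSpace.measurable_eq) isPiSystem_Iic ?_
  rintro _ ⟨c, rfl⟩
  refine measurable_of_Ioi fun q => ?_
  have h : (fun x => K x (Iic c)) ⁻¹' Ioi q =
      {x ∈ I | q < K x (Iic c)} ∪ {x ∈ Iᶜ | q < ρ (Iic c)} := by
    ext x
    by_cases hx : x ∈ I
    · simp [hx]
    · simp [hx, hρ x hx]
  rw [h]
  refine MeasurableSet.union (OrdConnected.measurableSet ⟨?_⟩) (hI.measurableSet.compl.inter ?_)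
  -- `x ↦ K x (Iic c)` is antitone on `I`, so its superlevel sets in `I` are order connected.
  · rintro a ⟨ha, _⟩ b ⟨hb, hqb⟩ x hx
    have hxI : x ∈ I := hI.out ha hb hx
    refine ⟨hxI, hqb.trans_le ?_⟩
    rcases hx.2.eq_or_lt with rfl | hlt
    · exact le_rfl
    · simpa using (hK x hxI b hb hlt).measure_Iic_le c
  · exact measurableSet_setOfPred.2 measurable_const

/-- A Markov kernel that fits between the slices of `R` in the likelihood ratio order disintegrates
`R`. -/
theorem compProd_eq_of_strictLRLe {R : Measure (ℝ × ℝ)} [IsFiniteMeasure R] {K : Kernel ℝ ℝ}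
    [IsMarkovKernel K] {I : Set ℝ} (hI : R.fst Iᶜ = 0)
    (hle : ∀ x ∈ I, ∀ D, MeasurableSet D → D ⊆ Ici x → StrictLRLe (K x) (slice R D))
    (hge : ∀ x ∈ I, ∀ D, MeasurableSet D → D ⊆ Iic x → StrictLRLe (slice R D) (K x)) :
    R = R.fst ⊗ₘ K := by
  have key : ∀ c : ℝ, ∀ A, MeasurableSet A →
      slice R A (Iic c) = ∫⁻ x in A, K x (Iic c) ∂(R.fst) := by
    intro c
    set μ := R.fst
    set ν := (R.restrict (univ ×ˢ Iic c)).fst with hν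
    have hνA : ∀ A, MeasurableSet A → ν A = slice R A (Iic c) := by
      intro A hA
      rw [hν, Measure.fst_apply hA, Measure.restrict_apply (measurable_fst hA),
        slice_apply R A measurableSet_Iic]
      congr 1
      ext p
      simp
    have hac : ν ≪ μ := by
      refine Measure.AbsolutelyContinuous.mk fun A hA h0 => ?_
      rw [hνA A hA]
      rw [← slice_apply_univ R hA] at h0
      exact measure_mono_null (subset_univ _) h0
    set g := ν.rnDeriv μ
    have hgm : Measurable g := Measure.measurable_rnDeriv _ _
    have hkm : Measurable fun x => K x (Iic c) := K.measurable_coe measurableSet_Iic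
    have hgA : ∀ A, MeasurableSet A → ν A = ∫⁻ x in A, g x ∂μ := fun A hA => by
      rw [← withDensity_apply _ hA, Measure.withDensity_rnDeriv_eq _ _ hac]
    have hfin : ∀ A, MeasurableSet A → ∫⁻ x in A, g x ∂μ ≠ ∞ := fun A hA => by
      rw [← hgA A hA]; exact measure_ne_top _ _
    have hIm : ∀ x ∈ I, ∀ D, MeasurableSet D → D ⊆ Ici x → ν D ≤ K x (Iic c) * μ D := by
      intro x hx D mD hD
      have := (hle x hx D mD hD).measure_Iic_le c
      rwa [measure_univ, mul_one, slice_apply_univ R mD, ← hνA D mD] at this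
    have hIp : ∀ x ∈ I, ∀ D, MeasurableSet D → D ⊆ Iic x → K x (Iic c) * μ D ≤ ν D := by
      intro x hx D mD hD
      have := (hge x hx D mD hD).measure_Iic_le c
      rwa [measure_univ (μ := K x), mul_one, slice_apply_univ R mD, ← hνA D mD] at this
    -- If `K x (Iic c) ≤ q < g` held on a non-null part `D` of `F ∩ Ici x`, integration would give
    -- `ν D > q * μ D`, against `ν D ≤ K x (Iic c) * μ D`. Only the endpoint `x` has to lie in `I`,
    -- so `I` is dropped and `D = F ∩ Ici x` is measurable.
    have h₁ : ∀ q : ℝ≥0∞, μ (I ∩ {x | K x (Iic c) ≤ q ∧ q < g x}) = 0 := by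
      intro q
      set F := {x | K x (Iic c) ≤ q ∧ q < g x}
      have mF : MeasurableSet F :=
        (measurableSet_le hkm measurable_const).inter (measurableSet_lt measurable_const hgm)
      refine measure_eq_zero_of_inter_Ici fun x hx => ?_
      refine measure_mono_null (t := F ∩ Ici x) (fun y hy => ⟨hy.1.2, hy.2⟩) ?_
      by_contra h0
      have mD := mF.inter (measurableSet_Ici (a := x))
      have hlt : ∫⁻ _ in F ∩ Ici x, q ∂μ < ∫⁻ y in F ∩ Ici x, g y ∂μ := by
        refine setLIntegral_strict_mono mD h0 hgm ?_ (.of_forall fun y hy => hy.1.2)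
        rw [setLIntegral_const]
        exact ENNReal.mul_ne_top hx.2.2.ne_top (measure_ne_top _ _)
      rw [← hgA _ mD, setLIntegral_const] at hlt
      refine hlt.not_ge ((hIm x hx.1 _ mD inter_subset_right).trans ?_)
      exact mul_le_mul_left hx.2.1 _
    have h₂ : ∀ q : ℝ≥0∞, μ (I ∩ {x | g x < q ∧ q ≤ K x (Iic c)}) = 0 := by
      intro q
      set F := {x | g x < q ∧ q ≤ K x (Iic c)}
      have mF : MeasurableSet F :=
        (measurableSet_lt hgm measurable_const).inter (measurableSet_le measurable_const hkm)
      refine measure_eq_zero_of_inter_Iic fun x hx => ?_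
      refine measure_mono_null (t := F ∩ Iic x) (fun y hy => ⟨hy.1.2, hy.2⟩) ?_
      by_contra h0
      have mD := mF.inter (measurableSet_Iic (a := x))
      have hlt : ∫⁻ y in F ∩ Iic x, g y ∂μ < ∫⁻ _ in F ∩ Iic x, q ∂μ :=
        setLIntegral_strict_mono mD h0 measurable_const (hfin _ mD) (.of_forall fun y hy => hy.1.1)
      rw [← hgA _ mD, setLIntegral_const] at hlt
      refine hlt.not_ge (le_trans ?_ (hIp x hx.1 _ mD inter_subset_right))
      exact mul_le_mul_left hx.2.2 _
    have hae : g =ᵐ[μ] fun x => K x (Iic c) := by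
      have e₁ : ∀ᵐ x ∂μ, ∀ q : ℚ, x ∉ I ∩ {x | K x (Iic c) ≤ (Real.toNNReal q : ℝ≥0∞) ∧
          (Real.toNNReal q : ℝ≥0∞) < g x} :=
        ae_all_iff.2 fun q => measure_eq_zero_iff_ae_notMem.1 (h₁ _)
      have e₂ : ∀ᵐ x ∂μ, ∀ q : ℚ, x ∉ I ∩ {x | g x < (Real.toNNReal q : ℝ≥0∞) ∧
          (Real.toNNReal q : ℝ≥0∞) ≤ K x (Iic c)} :=
        ae_all_iff.2 fun q => measure_eq_zero_iff_ae_notMem.1 (h₂ _)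
      filter_upwards [e₁, e₂, measure_eq_zero_iff_ae_notMem.1 hI] with x hx₁ hx₂ hxI
      rw [notMem_compl_iff] at hxI
      refine le_antisymm (not_lt.1 fun hlt => ?_) (not_lt.1 fun hlt => ?_)
      · obtain ⟨q, -, h, h'⟩ := ENNReal.lt_iff_exists_rat_btwn.1 hlt
        exact hx₁ q ⟨hxI, h.le, h'⟩
      · obtain ⟨q, -, h, h'⟩ := ENNReal.lt_iff_exists_rat_btwn.1 hlt
        exact hx₂ q ⟨hxI, h, h'.le⟩
    intro A hA
    rw [← hνA A hA, hgA A hA]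
    exact setLIntegral_congr_fun_ae hA (hae.mono fun x hx _ => hx)
  refine Measure.ext_prod fun {A B} hA hB => ?_
  rw [← slice_apply R A hB, ← slice_apply (R.fst ⊗ₘ K) A hB]
  congr 1
  refine Measure.ext_of_Iic _ _ fun c => ?_
  rw [key c A hA, slice_apply _ A measurableSet_Iic,
    Measure.compProd_apply_prod hA measurableSet_Iic]

/-! ### The boundaries in terms of slices -/

section Pair

variable {Ω : Type*} [MeasurableSpace Ω] {P : Measure Ω} {X Y : Ω → ℝ}

theorem slice_map_apply (hX : Measurable X) (hY : Measurable Y) {A B : Set ℝ}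
    (hA : MeasurableSet A) (hB : MeasurableSet B) :
    slice (P.map fun ω => (X ω, Y ω)) A B = P {ω | X ω ∈ A ∧ Y ω ∈ B} := by
  rw [slice_apply _ A hB, Measure.map_apply (hX.prodMk hY) (hA.prod hB)]
  rfl

theorem measurableSet_coe_le (s : EReal) : MeasurableSet {y : ℝ | (y : EReal) ≤ s} :=
  measurableSet_le measurable_coe_real_ereal measurable_const

theorem measurableSet_coe_lt (s : EReal) : MeasurableSet {y : ℝ | (y : EReal) < s} :=
  measurableSet_lt measurable_coe_real_ereal measurable_const

theorem isLowerSet_coe_le (s : EReal) : IsLowerSet {y : ℝ | (y : EReal) ≤ s} :=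
  fun _ _ hab ha => (EReal.coe_le_coe_iff.2 hab).trans ha

theorem slice_Iic_Snw (hX : Measurable X) (hY : Measurable Y) (x : ℝ) :
    slice (P.map fun ω => (X ω, Y ω)) (Iic x) {y : ℝ | (y : EReal) ≤ Snw P X Y x}ᶜ = 0 := by
  rw [slice_map_apply hX hY measurableSet_Iic (measurableSet_coe_le _).compl]
  simpa using (isLeast_Snw P X Y x).1

theorem slice_Ici_Sse (hX : Measurable X) (hY : Measurable Y) (x : ℝ) :
    slice (P.map fun ω => (X ω, Y ω)) (Ici x) {y : ℝ | (y : EReal) < Sse P X Y x} = 0 := by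
  rw [slice_map_apply hX hY measurableSet_Ici (measurableSet_coe_lt _)]
  simpa using (isGreatest_Sse P X Y x).1

theorem Snw_mono (P : Measure Ω) (X Y : Ω → ℝ) : Monotone (Snw P X Y) := by
  intro x₁ x₂ h
  refine (isLeast_Snw P X Y x₁).2 (measure_mono_null ?_ (isLeast_Snw P X Y x₂).1)
  exact fun ω hω => ⟨hω.1.trans h, hω.2⟩

theorem Snw_ne_bot {x : ℝ} (hx : x ∈ range P X) : Snw P X Y x ≠ ⊥ := by
  intro h
  have := (isLeast_Snw P X Y x).1
  rw [h] at this
  simp only [mem_ofPred_eq, EReal.bot_lt_coe, and_true] at this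
  exact hx.1.ne' this

theorem Sse_ne_top {x : ℝ} (hx : x ∈ range P X) : Sse P X Y x ≠ ⊤ := by
  intro h
  have := (isGreatest_Sse P X Y x).1
  rw [h] at this
  simp only [mem_ofPred_eq, EReal.coe_lt_top, and_true] at this
  exact hx.2.ne' this

/-- `Snw` itself is a selection: on `rangeO` it is finite, being above `⊥` and at most `Sse < ⊤`. -/
theorem exists_isIsotonicSelection (P : Measure Ω) (X Y : Ω → ℝ) :
    ∃ S : ℝ → ℝ, IsIsotonicSelection P X Y S := by
  have h : ∀ x ∈ rangeO P X Y, ((Snw P X Y x).toReal : EReal) = Snw P X Y x := fun x hx =>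
    EReal.coe_toReal (fun h => Sse_ne_top hx.1 (top_le_iff.1 (h ▸ hx.2))) (Snw_ne_bot hx.1)
  refine ⟨fun x => (Snw P X Y x).toReal, fun x₁ h₁ x₂ h₂ hle => ?_, fun x hx => ?_⟩
  · rw [← EReal.coe_le_coe_iff, h x₁ h₁, h x₂ h₂]
    exact Snw_mono P X Y hle
  · rw [h x hx]
    exact ⟨le_rfl, hx.2⟩

theorem ordConnected_range (P : Measure Ω) (X : Ω → ℝ) : (range P X).OrdConnected :=
  ⟨fun _ ha _ hb _ hx => ⟨ha.1.trans_le (measure_mono fun _ hω => le_trans hω hx.1),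
    hb.2.trans_le (measure_mono fun _ hω => le_trans hx.2 hω)⟩⟩

theorem map_compl_range (hX : Measurable X) : P.map X (range P X)ᶜ = 0 := by
  have h₁ : P.map X {x | P {ω | X ω ≤ x} = 0} = 0 :=
    measure_eq_zero_of_inter_Iic fun x hx => measure_mono_null inter_subset_right <| by
      rw [Measure.map_apply hX measurableSet_Iic]; exact hx
  have h₂ : P.map X {x | P {ω | x ≤ X ω} = 0} = 0 :=
    measure_eq_zero_of_inter_Ici fun x hx => measure_mono_null inter_subset_right <| by
      rw [Measure.map_apply hX measurableSet_Ici]; exact hx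
  refine measure_mono_null (fun x hx => ?_) (measure_union_null h₁ h₂)
  by_contra hcon
  simp only [mem_union, mem_ofPred_eq, not_or] at hcon
  exact hx ⟨pos_iff_ne_zero.2 hcon.1, pos_iff_ne_zero.2 hcon.2⟩

/-- Any real `y` strictly between `Sse` and `Snw` works: minimality of `Snw` and maximality of `Sse`
give the two positive masses. -/
theorem exists_isRightLimit_of_mem [IsFiniteMeasure P] (hX : Measurable X) (hY : Measurable Y)
    (hTP2 : IsTP2Measure (P.map fun ω => (X ω, Y ω))) {x : ℝ}
    (hx : x ∈ range P X \ rangeO P X Y) :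
    ∃ κ, IsRightLimit (P.map fun ω => (X ω, Y ω)) x {y : ℝ | (y : EReal) ≤ Snw P X Y x} κ := by
  have hlt : Sse P X Y x < Snw P X Y x := not_le.1 fun h => hx.2 ⟨hx.1, h⟩
  obtain ⟨y, hy₁, hy₂⟩ := EReal.lt_iff_exists_real_btwn.1 hlt
  refine exists_isRightLimit hTP2 (y := y) (measurableSet_coe_le _) (isLowerSet_coe_le _)
    (fun t ht => (EReal.coe_lt_coe_iff.2 ht).le.trans hy₂.le) (slice_Iic_Snw hX hY x) ?_ ?_
  · rw [slice_map_apply hX hY measurableSet_Iic measurableSet_Ici]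
    refine fun h => hy₂.not_ge ((isLeast_Snw P X Y x).2 (measure_mono_null ?_ h))
    exact fun ω hω => ⟨hω.1, (EReal.coe_lt_coe_iff.1 hω.2).le⟩
  · rw [slice_map_apply hX hY measurableSet_Ici measurableSet_Iio]
    refine fun h => hy₁.not_ge ((isGreatest_Sse P X Y x).2 (measure_mono_null ?_ h))
    exact fun ω hω => ⟨hω.1, EReal.coe_lt_coe_iff.1 hω.2⟩

namespace IsIsotonicSelection

variable {S : ℝ → ℝ} {x : ℝ}

theorem slice_Iic_Ioi (hS : IsIsotonicSelection P X Y S) (hx : x ∈ rangeO P X Y)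
    (hX : Measurable X) (hY : Measurable Y) :
    slice (P.map fun ω => (X ω, Y ω)) (Iic x) (Ioi (S x)) = 0 :=
  measure_mono_null (fun _ hy => not_le.2 ((hS.2 x hx).1.trans_lt (EReal.coe_lt_coe_iff.2 hy)))
    (slice_Iic_Snw hX hY x)

theorem slice_Ici_Iio (hS : IsIsotonicSelection P X Y S) (hx : x ∈ rangeO P X Y)
    (hX : Measurable X) (hY : Measurable Y) :
    slice (P.map fun ω => (X ω, Y ω)) (Ici x) (Iio (S x)) = 0 :=
  measure_mono_null (fun _ hy => (EReal.coe_lt_coe_iff.2 hy).trans_le (hS.2 x hx).2)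
    (slice_Ici_Sse hX hY x)

theorem slice_strictLRLe_dirac (hS : IsIsotonicSelection P X Y S) (hx : x ∈ rangeO P X Y)
    (hX : Measurable X) (hY : Measurable Y) {D : Set ℝ}
    (hD : D ⊆ Iic x) :
    StrictLRLe (slice (P.map fun ω => (X ω, Y ω)) D) (Measure.dirac (S x)) :=
  .of_separated (le_antisymm ((slice_mono_apply _ hD _).trans (hS.slice_Iic_Ioi hx hX hY).le)
    bot_le) (by simp)

theorem dirac_strictLRLe_slice (hS : IsIsotonicSelection P X Y S) (hx : x ∈ rangeO P X Y)
    (hX : Measurable X) (hY : Measurable Y) {D : Set ℝ}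
    (hD : D ⊆ Ici x) :
    StrictLRLe (Measure.dirac (S x)) (slice (P.map fun ω => (X ω, Y ω)) D) :=
  .of_separated (by simp) (le_antisymm ((slice_mono_apply _ hD _).trans
    (hS.slice_Ici_Iio hx hX hY).le) bot_le)

end IsIsotonicSelection

end Pair

end LikelihoodRatio

/-! ### Assembly of the kernel and its density. -/

open LikelihoodRatio in
theorem theorem3 {Ω : Type*} [MeasurableSpace Ω] (P : Measure Ω) [IsProbabilityMeasure P]
    (X Y : Ω → ℝ) (hX : Measurable X) (hY : Measurable Y)
    (hTP2 : LikelihoodRatio.IsTP2Measure (P.map fun ω => (X ω, Y ω))) :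
    (∃ S : ℝ → ℝ, LikelihoodRatio.IsIsotonicSelection P X Y S) ∧
    ∀ S : ℝ → ℝ, LikelihoodRatio.IsIsotonicSelection P X Y S →
      ∃ K : Kernel ℝ ℝ, IsMarkovKernel K ∧ HasCondDistrib Y X K P ∧
        (∀ x₁ ∈ LikelihoodRatio.range P X, ∀ x₂ ∈ LikelihoodRatio.range P X, x₁ < x₂ →
          LikelihoodRatio.LRLe (K x₁) (K x₂)) ∧
        (∀ x ∈ LikelihoodRatio.rangeO P X Y, K x = Measure.dirac (S x)) ∧
        ∃ h : ℝ → ℝ → ℝ,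
          (∀ x ∈ LikelihoodRatio.range P X \ LikelihoodRatio.rangeO P X Y,
            LikelihoodRatio.IsBoundedDensity (h x) (K x) (P.map Y) ∧
            ∀ y : ℝ, ((y : EReal) < LikelihoodRatio.Sse P X Y x ∨
              LikelihoodRatio.Snw P X Y x < (y : EReal)) → h x y = 0) ∧
          LikelihoodRatio.IsTP2On h
            (LikelihoodRatio.range P X \ LikelihoodRatio.rangeO P X Y) := by
  refine ⟨exists_isIsotonicSelection P X Y, fun S hS => ?_⟩
  set R := P.map fun ω => (X ω, Y ω)
  have : IsProbabilityMeasure R := Measure.isProbabilityMeasure_map (hX.prodMk hY).aemeasurable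
  have hfst : R.fst = P.map X := Measure.fst_map_prodMk hY
  have hsnd : R.snd = P.map Y := Measure.snd_map_prodMk hX
  choose! κ hκ using fun x hx => exists_isRightLimit_of_mem hX hY hTP2 (x := x) hx
  classical
  -- Outside the range, a set null for the law of `X`, the value `δ_0` is arbitrary; it only has to
  -- be constant there for measurability.
  let K₀ : ℝ → Measure ℝ := fun x =>
    if x ∈ rangeO P X Y then Measure.dirac (S x)
    else if x ∈ LikelihoodRatio.range P X then κ x else Measure.dirac 0
  have hKo : ∀ x ∈ rangeO P X Y, K₀ x = Measure.dirac (S x) := fun x hx => if_pos hx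
  have hKd : ∀ x ∈ LikelihoodRatio.range P X \ rangeO P X Y, K₀ x = κ x := fun x hx => by
    simp only [K₀, if_neg hx.2, if_pos hx.1]
  have hKout : ∀ x ∉ LikelihoodRatio.range P X, K₀ x = Measure.dirac 0 := fun x hx => by
    simp only [K₀, if_neg hx, if_neg fun h : x ∈ rangeO P X Y => hx h.1]
  have hprob : ∀ x, IsProbabilityMeasure (K₀ x) := by
    intro x
    by_cases hx : x ∈ LikelihoodRatio.range P X
    · by_cases hxo : x ∈ rangeO P X Y
      · rw [hKo x hxo]; infer_instance
      · rw [hKd x ⟨hx, hxo⟩]; exact (hκ x ⟨hx, hxo⟩).prob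
    · rw [hKout x hx]; infer_instance
  have hle : ∀ x ∈ LikelihoodRatio.range P X, ∀ D, MeasurableSet D → D ⊆ Ici x →
      StrictLRLe (K₀ x) (slice R D) := by
    intro x hx D mD hD
    by_cases hxo : x ∈ rangeO P X Y
    · rw [hKo x hxo]; exact hS.dirac_strictLRLe_slice hxo hX hY hD
    · rw [hKd x ⟨hx, hxo⟩]; exact (hκ x ⟨hx, hxo⟩).le_slice D mD hD
  have hge : ∀ x ∈ LikelihoodRatio.range P X, ∀ D, MeasurableSet D → D ⊆ Iic x →
      StrictLRLe (slice R D) (K₀ x) := by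
    intro x hx D mD hD
    by_cases hxo : x ∈ rangeO P X Y
    · rw [hKo x hxo]; exact hS.slice_strictLRLe_dirac hxo hX hY hD
    · rw [hKd x ⟨hx, hxo⟩]; exact (hκ x ⟨hx, hxo⟩).slice_le D mD hD
  have hLR : ∀ x₁ ∈ LikelihoodRatio.range P X, ∀ x₂ ∈ LikelihoodRatio.range P X, x₁ < x₂ →
      StrictLRLe (K₀ x₁) (K₀ x₂) := by
    intro x₁ h₁ x₂ h₂ hlt
    -- Pairs involving a Dirac measure are separated by its atom; in the third case this relies on
    -- the cut-off at `Snw x₁ ≤ S x₂`.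
    by_cases ho₁ : x₁ ∈ rangeO P X Y <;> by_cases ho₂ : x₂ ∈ rangeO P X Y
    · rw [hKo x₁ ho₁, hKo x₂ ho₂]
      exact .of_separated (s := S x₁) (by simp) (by simpa using hS.1 ho₁ ho₂ hlt.le)
    · rw [hKo x₁ ho₁, hKd x₂ ⟨h₂, ho₂⟩]
      refine .of_separated (s := S x₁) (by simp) ?_
      exact (hκ x₂ ⟨h₂, ho₂⟩).eq_zero _ measurableSet_Iio (le_antisymm ((slice_mono_apply _
        (Ici_subset_Ici.2 hlt.le) _).trans (hS.slice_Ici_Iio ho₁ hX hY).le) bot_le)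
    · rw [hKd x₁ ⟨h₁, ho₁⟩, hKo x₂ ho₂]
      refine .of_separated (s := S x₂) (measure_mono_null (fun y hy => ?_)
        (hκ x₁ ⟨h₁, ho₁⟩).compl_eq_zero) (by simp)
      exact not_le.2 (((Snw_mono P X Y hlt.le).trans (hS.2 x₂ ho₂).1).trans_lt
        (EReal.coe_lt_coe_iff.2 hy))
    · rw [hKd x₁ ⟨h₁, ho₁⟩, hKd x₂ ⟨h₂, ho₂⟩]
      exact (hκ x₁ ⟨h₁, ho₁⟩).strictLRLe (hκ x₂ ⟨h₂, ho₂⟩) hlt.le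
        (fun y hy => le_trans hy (Snw_mono P X Y hlt.le)) (measurableSet_coe_le _)
  let K : Kernel ℝ ℝ := ⟨K₀, measurable_of_strictLRLe (ordConnected_range P X) hKout hLR⟩
  have hK : IsMarkovKernel K := ⟨hprob⟩
  have hfin : ∀ x ∈ LikelihoodRatio.range P X \ rangeO P X Y, ∀ y,
      ballDensity (K₀ x) R.snd y ≠ ∞ := fun x hx y => by
    obtain ⟨C, hC, hb⟩ := (hκ x hx).le_mul
    rw [hKd x hx]
    exact ((ballDensity_le hb y).trans_lt hC.lt_top).ne
  refine ⟨K, hK, ⟨(hX.prodMk hY).aemeasurable, ?_⟩, fun x₁ h₁ x₂ h₂ h => (hLR x₁ h₁ x₂ h₂ h).lrLe,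
    hKo, fun x y => (ballDensity (K₀ x) R.snd y).toReal, fun x hx => ⟨?_, fun y hy => ?_⟩, ?_⟩
  · rw [← hfst]
    exact compProd_eq_of_strictLRLe (K := K) (by rw [hfst]; exact map_compl_range hX) hle hge
  · obtain ⟨C, hC, hb⟩ := (hκ x hx).le_mul
    rw [← hKd x hx] at hb
    rw [← hsnd]
    refine isBoundedDensity_ballDensity hC hb ?_
    -- `Q` is split into the slices left and right of `x`, between which `K₀ x` is sandwiched.
    rw [← slice_univ, ← Iio_union_Ici (a := x), slice_union measurableSet_Ici
      (disjoint_left.2 fun y hy hy' => (mem_Iio.1 hy).not_ge hy')]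
    exact measurable_ballDensity (hge x hx.1 _ measurableSet_Iio Iio_subset_Iic_self)
      (hle x hx.1 _ measurableSet_Ici subset_rfl)
  · refine (ENNReal.toReal_eq_zero_iff _).2 (.inl ?_)
    rw [hKd x hx]
    rcases hy with hy | hy
    · exact ballDensity_eq_zero ((isOpen_Iio.preimage continuous_coe_real_ereal).mem_nhds hy)
        ((hκ x hx).eq_zero _ (measurableSet_coe_lt _) (slice_Ici_Sse hX hY x))
    · exact ballDensity_eq_zero ((isOpen_Ioi.preimage continuous_coe_real_ereal).mem_nhds hy)
        (measure_mono_null (t := {y : ℝ | (y : EReal) ≤ Snw P X Y x}ᶜ)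
          (fun y (hy : Snw P X Y x < y) => not_le.2 hy) (hκ x hx).compl_eq_zero)
  · intro x₁ h₁ x₂ h₂ hlt y₁ y₂ hy
    rw [← ENNReal.toReal_mul, ← ENNReal.toReal_mul]
    exact ENNReal.toReal_mono (ENNReal.mul_ne_top (hfin x₁ h₁ _) (hfin x₂ h₂ _))
      ((hLR x₁ h₁.1 x₂ h₂.1 hlt).ballDensity_mul_le (hfin x₁ h₁) (hfin x₂ h₂) hy)
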